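/- A polytope is the convex hull of a nonempty finite set of points in some $\mathbb{R}^N$. A $d$-polytope is neighborly if every set of $\lfloor d/2\rfloor$ of its vertices is the vertex set of a face. A polytope $P$ is a quotient of a polytope $Q$ if there is a face $F$ of $Q$ such that the face lattice of $P$ is isomorphic to the interval of all faces of $Q$ containing $F$ (the face lattice of $Q/F$); here $\emptyset$ and $Q$ count as faces. (i) There is a $5$-polytope $P$ with exactly $9$ vertices, labelled $1,\dots,9$, whose facets are exactly the convex hulls of the following $24$ vertex sets, and it is simplicial: $$\begin{aligned}&12378,\ 12379,\ 12389,\ 12579,\ 13479,\ 12589,\ 13489,\ 23679,\\ &23689,\ 14579,\ 14589,\ 25679,\ 34679,\ 25689,\ 34689,\ 45679,\\ &45689,\ 12578,\ 13478,\ 23678,\ 14578,\ 25678,\ 34678,\ 45678.\end{aligned}$$ (ii) If $P$ is any $5$-polytope as in (i), then every neighborly polytope (of any dimension) that has $P$ as a quotient has at least $13$ vertices. (iii) Consequently, for $d=5$ there is a simplicial $d$-polytope with $d+4$ vertices that is not a quotient of any neighborly $(2d-2)$-polytope with $2d+2$ vertices. In particular, it is not true that for every $d\ge 2$ every simplicial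 $d$-polytope with $d+4$ vertices is a quotient of a neighborly $(2d-2)$-polytope with $2d+2$ vertices. -/

import Mathlib

section Polytopes

variable {E : Type*} [NormedAddCommGroup E] [NormedSpace ℝ E]

/-- A (nonempty) convex polytope: the convex hull of a nonempty finite set of points. -/
def IsPolytope (P : Set E) : Prop :=
  ∃ s : Finset E, s.Nonempty ∧ P = convexHull ℝ (s : Set E)

/-- The dimension of a nonempty convex set, i.e. the dimension of its affine hull. -/
noncomputable def polytopeDim (P : Set E) : ℕ :=
  Module.finrank ℝ (vectorSpan ℝ P)

/-- The number of vertices (extreme points) of a polytope. -/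
noncomputable def numVertices (P : Set E) : ℕ :=
  (P.extremePoints ℝ).ncard

/-- The faces of `P` ordered by inclusion. `IsExposed ℝ P F` says that `F` is empty or the set of
maximizers on `P` of a linear functional, so `∅` and `P` are faces. -/
abbrev PolytopeFace (P : Set E) : Type _ :=
  {F : Set E // IsExposed ℝ P F}

/-- Facets: the nonempty faces of codimension one. -/
def IsPolytopeFacet (P F : Set E) : Prop :=
  IsExposed ℝ P F ∧ F.Nonempty ∧ polytopeDim F + 1 = polytopeDim P

/-- A polytope is simplicial if every facet is a simplex, i.e. has affinely independent vertices. -/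
def IsSimplicial (P : Set E) : Prop :=
  ∀ F : Set E, IsPolytopeFacet P F →
    AffineIndependent ℝ (fun x : F.extremePoints ℝ => (x : E))

/-- `P` is `k`-neighborly if every set of `k` vertices of `P` is the vertex set of a face of `P`. -/
def IsKNeighborly (k : ℕ) (P : Set E) : Prop :=
  ∀ s : Finset E, (s : Set E) ⊆ P.extremePoints ℝ → s.card = k →
    IsExposed ℝ P (convexHull ℝ (s : Set E))

/-- A `d`-polytope is neighborly if it is `⌊d/2⌋`-neighborly. -/
def IsNeighborly (P : Set E) : Prop :=
  IsKNeighborly (polytopeDim P / 2) P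

/-- `P` is (combinatorially) a quotient of `Q`: for some face `F` of `Q`, the face lattice of `P` is
isomorphic to the face lattice of `Q / F`, which is the interval of all faces of `Q` that
contain `F`. -/
def IsQuotientOf {E' : Type*} [NormedAddCommGroup E'] [NormedSpace ℝ E']
    (P : Set E) (Q : Set E') : Prop :=
  ∃ F : PolytopeFace Q, Nonempty (PolytopeFace P ≃o Set.Ici F)

/-- The vertex sets of the facets of the special 5-polytope with vertices labelled `1, …, 9`. -/
def specialFacets : Finset (Finset ℕ) :=
  {{1, 2, 3, 7, 8}, {1, 2, 3, 7, 9}, {1, 2, 3, 8, 9}, {1, 2, 5, 7, 9},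
   {1, 3, 4, 7, 9}, {1, 2, 5, 8, 9}, {1, 3, 4, 8, 9}, {2, 3, 6, 7, 9},
   {2, 3, 6, 8, 9}, {1, 4, 5, 7, 9}, {1, 4, 5, 8, 9}, {2, 5, 6, 7, 9},
   {3, 4, 6, 7, 9}, {2, 5, 6, 8, 9}, {3, 4, 6, 8, 9}, {4, 5, 6, 7, 9},
   {4, 5, 6, 8, 9}, {1, 2, 5, 7, 8}, {1, 3, 4, 7, 8}, {2, 3, 6, 7, 8},
   {1, 4, 5, 7, 8}, {2, 5, 6, 7, 8}, {3, 4, 6, 7, 8}, {4, 5, 6, 7, 8}}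

/-- `P` is a realization of the special polytope: a 5-polytope whose vertices can be labelled
bijectively by `1, …, 9` such that its facets are exactly the convex hulls of the listed sets. -/
def IsSpecialPolytope (P : Set E) : Prop :=
  IsPolytope P ∧ polytopeDim P = 5 ∧
    ∃ v : ℕ → E, Set.BijOn v (Set.Icc 1 9) (P.extremePoints ℝ) ∧
      {F : Set E | IsPolytopeFacet P F} =
        {F : Set E | ∃ s ∈ specialFacets, F = convexHull ℝ (v '' (s : Set ℕ))}

end Polytopes

/-!
The special polytope `P` is the free sum of three segments, with vertex sets `16`, `24`, `35`, and a
triangle `789`. These four sets are its minimal non-faces, and its facets are the complements of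
their transversals. It is realized by the vertices `±e₁`, `±e₂`, `±e₃`, `e₄`, `e₅`, `-e₄ - e₅`.

For the lower bound, suppose that the faces of a neighborly `d`-polytope `Q` that contain a face `F`
form the face lattice of `P`. For every vertex `i` of `P` choose a vertex `q i` of `Q` outside `F` on
the face of `Q` that corresponds to `i` (`IsSpecialPolytope.exists_isSpecialQuotient`). That no
proper face of `P` contains a minimal non-face uses that every proper face of a polytope lies in a
facet (`IsPolytope.exists_facet`). Let `F` have `m` vertices and let `Q` be `k`-neighborly,
`k = ⌊d / 2⌋`, with at most 12 vertices. Then: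

* `m + 9 ≤ 12`, so `m ≤ 3`. The vertices of `F` together with those chosen on a facet of `P` are
  affinely independent, so `m + 5 ≤ d` (`IsSpecialQuotient.card_add_five_le_polytopeDim`).
* For a minimal non-face `C`, the vertices of `F` together with `q '' C` lie in no proper face, so
  there is an affine dependence `f_C` of the vertices of `Q` whose positive entries are among them
  (`exists_isAffineDependence_nonpos_off`). By neighborliness it has more than `k` positive entries
  (`IsKNeighborly.lt_card_pos`). For a segment `C` this gives `k ≤ m + 1`, hence `k = m + 1` and
  `m ∈ {2, 3}`, and `f_C` is positive on all of `F`. For the triangle, `f_C` is positive at some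
  vertex `a` of `F`.
* By neighborliness again, every vertex of `Q` outside `F` is some `q i`.

All four dependences are thus positive at the vertex `a` of `F`. In the Gale dual, the vectors of a
transversal of the four minimal non-faces span their space positively, so the vector of `a` lies in
a cone spanned by three of them, say omitting the one in `C`. Being nonpositive on these three
vectors, `f_C` cannot be positive at `a` (`IsSpecialQuotient.false_of_dependences`).
-/

/-! ### Faces of polytopes and supporting functionals -/

section Faces

variable {E : Type*} [NormedAddCommGroup E] [NormedSpace ℝ E] {P F G : Set E}

theorem IsPolytope.isCompact (hP : IsPolytope P) : IsCompact P := by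
  obtain ⟨s, -, rfl⟩ := hP
  exact s.finite_toSet.isCompact_convexHull ℝ

theorem IsPolytope.convex (hP : IsPolytope P) : Convex ℝ P := by
  obtain ⟨s, -, rfl⟩ := hP
  exact convex_convexHull ℝ _

theorem IsPolytope.finite_extremePoints (hP : IsPolytope P) : (P.extremePoints ℝ).Finite := by
  obtain ⟨s, -, rfl⟩ := hP
  exact s.finite_toSet.subset extremePoints_convexHull_subset

/-- A face of a polytope is the convex hull of the vertices of the polytope that it contains. -/
theorem IsPolytope.convexHull_extremePoints_inter (hP : IsPolytope P) (hF : IsExposed ℝ P F) :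
    convexHull ℝ (P.extremePoints ℝ ∩ F) = F := by
  have h := closure_convexHull_extremePoints (hF.isCompact hP.isCompact) (hF.convex hP.convex)
  rw [hF.isExtreme.extremePoints_eq, Set.inter_comm] at h
  rwa [((hP.finite_extremePoints.inter_of_left F).isClosed_convexHull ℝ).closure_eq] at h

theorem IsPolytope.convexHull_extremePoints (hP : IsPolytope P) :
    convexHull ℝ (P.extremePoints ℝ) = P := by
  have h := hP.convexHull_extremePoints_inter (IsExposed.refl (𝕜 := ℝ) P)
  rwa [Set.inter_eq_left.2 extremePoints_subset] at h

theorem IsPolytope.face_subset_of_extremePoints (hP : IsPolytope P) (hF : IsExposed ℝ P F)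
    (hG : IsExposed ℝ P G) (h : ∀ v ∈ P.extremePoints ℝ, v ∈ F → v ∈ G) : F ⊆ G := by
  rw [← hP.convexHull_extremePoints_inter hF]
  exact convexHull_min (fun v hv => h v hv.1 hv.2) (hG.convex hP.convex)

theorem IsPolytope.finite_faces (hP : IsPolytope P) : {F : Set E | IsExposed ℝ P F}.Finite := by
  refine Set.Finite.of_finite_image (f := fun F => P.extremePoints ℝ ∩ F)
    (hP.finite_extremePoints.finite_subsets.subset ?_) ?_
  · rintro _ ⟨F, -, rfl⟩
    exact Set.inter_subset_left
  · intro F hF G hG h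
    rw [← hP.convexHull_extremePoints_inter hF, ← hP.convexHull_extremePoints_inter hG]
    exact congrArg _ h

/-- Every face, the empty one and `P` included, is cut out by a valid linear inequality. -/
theorem IsExposed.exists_support (hF : IsExposed ℝ P F) :
    ∃ (l : StrongDual ℝ E) (c : ℝ), (∀ x ∈ P, l x ≤ c) ∧ ∀ x ∈ P, l x = c ↔ x ∈ F := by
  rcases F.eq_empty_or_nonempty with rfl | ⟨y, hy⟩
  · exact ⟨0, 1, by simp, by simp⟩
  · obtain ⟨l, hl⟩ := hF ⟨y, hy⟩
    rw [hl] at hy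
    refine ⟨l, l y, hy.2, fun x hx => ?_⟩
    rw [hl]
    exact ⟨fun h => ⟨hx, fun z hz => h ▸ hy.2 z hz⟩,
      fun h => le_antisymm (hy.2 x hx) (h.2 y hy.1)⟩

theorem isExposed_of_le {l : StrongDual ℝ E} {c : ℝ} (h : ∀ x ∈ P, l x ≤ c) :
    IsExposed ℝ P {x ∈ P | l x = c} := by
  rintro ⟨y, hy, hyc⟩
  refine ⟨l, Set.ext fun x => and_congr_right fun hx => ?_⟩
  exact ⟨fun hc z hz => hc ▸ h z hz, fun hm => le_antisymm (h x hx) (hyc ▸ hm y hy)⟩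

theorem le_of_mem_convexHull {S : Set E} {l : StrongDual ℝ E} {c : ℝ} (h : ∀ x ∈ S, l x ≤ c) :
    ∀ x ∈ convexHull ℝ S, l x ≤ c :=
  convexHull_min h (convex_halfSpace_le l.isLinear c)

theorem eq_of_mem_convexHull {S : Set E} {l : StrongDual ℝ E} {c : ℝ} (h : ∀ x ∈ S, l x = c) :
    ∀ x ∈ convexHull ℝ S, l x = c :=
  convexHull_min h (convex_hyperplane l.isLinear c)

/-- A vertex lying in the convex hull of some vertices is one of them. -/
theorem mem_of_mem_convexHull_extremePoints {S : Set E} {x : E} (hP : Convex ℝ P)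
    (hS : S ⊆ P.extremePoints ℝ) (hx : x ∈ P.extremePoints ℝ) (h : x ∈ convexHull ℝ S) :
    x ∈ S := by
  by_contra hxS
  refine (hP.mem_extremePoints_iff_mem_sdiff_convexHull_sdiff.1 hx).2 (convexHull_mono ?_ h)
  exact fun y hy => ⟨extremePoints_subset (hS hy), fun hyx => hxS (hyx ▸ hy)⟩

variable [FiniteDimensional ℝ E]

/-- A compact convex set disjoint from an affine subspace lies strictly on one side of a
hyperplane containing that subspace. -/
theorem exists_dual_eq_of_disjoint_affineSpan {S K : Set E} (hS : S.Nonempty) (hK : IsCompact K)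
    (hKc : Convex ℝ K) (hd : Disjoint K (affineSpan ℝ S : Set E)) :
    ∃ (l : StrongDual ℝ E) (c : ℝ), (∀ x ∈ S, l x = c) ∧ ∀ x ∈ K, l x < c := by
  obtain ⟨l, u, v, hu, huv, hv⟩ := geometric_hahn_banach_compact_closed hKc hK
    (affineSpan ℝ S).convex (affineSpan ℝ S).closed_of_finiteDimensional hd
  have hconst : ∀ x ∈ S, ∀ y ∈ S, l x = l y := by
    intro x hx y hy
    by_contra hne
    -- on the line through `x` and `y` a nonconstant `l` would take the value `v`
    have hmem := AffineMap.lineMap_mem ((v - l y) / (l x - l y))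
      (subset_affineSpan ℝ S hy) (subset_affineSpan ℝ S hx)
    have h := hv _ hmem
    rw [AffineMap.lineMap_apply, vsub_eq_sub, vadd_eq_add, map_add, map_smul, map_sub,
      smul_eq_mul, div_mul_cancel₀ _ (sub_ne_zero.2 hne)] at h
    linarith
  obtain ⟨y, hy⟩ := hS
  exact ⟨l, l y, fun x hx => hconst x hx y hy,
    fun x hx => (hu x hx).trans (huv.trans (hv y (subset_affineSpan ℝ S hy)))⟩

/-- A maximal proper face is a facet: a functional defining a face of smaller dimension can be
rotated about that face until the hyperplane meets a further vertex. -/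
theorem IsPolytope.exists_facet (hP : IsPolytope P) (hF : IsExposed ℝ P F) (hne : F.Nonempty)
    (hFP : F ≠ P) : ∃ G, IsPolytopeFacet P G ∧ F ⊆ G := by
  obtain ⟨G, hFG, hG⟩ := (hP.finite_faces.subset
    (fun G (hG : IsExposed ℝ P G ∧ G ≠ P) => hG.1)).exists_le_maximal (a := F) ⟨hF, hFP⟩
  obtain ⟨⟨hGe, hGP⟩, hmax⟩ := hG
  refine ⟨G, ⟨hGe, hne.mono hFG, ?_⟩, hFG⟩
  obtain ⟨l, c, hlc, hlG⟩ := hGe.exists_support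
  obtain ⟨g₀, hg₀⟩ := hne.mono hFG
  have hVP : ∀ v ∈ P.extremePoints ℝ, v ∈ P := fun v hv => extremePoints_subset hv
  have hGsub : G ⊆ P := hGe.subset
  have hl₀ : l g₀ = c := (hlG g₀ (hGsub hg₀)).2 hg₀
  obtain ⟨w, hwP, hwG⟩ : ∃ w ∈ P, w ∉ G := by
    by_contra! h
    exact hGP (hGsub.antisymm h)
  have hlw : l (w - g₀) ≠ 0 := by
    rw [map_sub, sub_ne_zero, hl₀]
    exact fun h => hwG ((hlG w hwP).1 h)
  have hker : ∀ u ∈ vectorSpan ℝ G, l u = 0 := by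
    intro u hu
    refine (Submodule.span_le (p := l.ker)).2 ?_ hu
    rintro _ ⟨x, hx, y, hy, rfl⟩
    change l (x - y) = 0
    rw [map_sub, (hlG x (hGsub hx)).2 hx, (hlG y (hGsub hy)).2 hy, sub_self]
  have hwmem : w - g₀ ∈ vectorSpan ℝ P := vsub_mem_vectorSpan ℝ hwP (hGsub hg₀)
  have hle : vectorSpan ℝ G ⊔ Submodule.span ℝ {w - g₀} ≤ vectorSpan ℝ P :=
    sup_le (vectorSpan_mono ℝ hGsub) ((Submodule.span_singleton_le_iff_mem _ _).2 hwmem)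
  have hwn : w - g₀ ∉ vectorSpan ℝ G := fun h => hlw (hker _ h)
  have hw0 : w - g₀ ≠ 0 := fun h => hwn (h ▸ zero_mem _)
  have hfin : Module.finrank ℝ ↥(vectorSpan ℝ G ⊔ Submodule.span ℝ {w - g₀})
      = Module.finrank ℝ (vectorSpan ℝ G) + 1 := by
    have h := Submodule.finrank_sup_add_finrank_inf_eq (vectorSpan ℝ G)
      (Submodule.span ℝ {w - g₀})
    rw [((Submodule.disjoint_span_singleton' hw0).2 hwn).eq_bot, finrank_bot,
      finrank_span_singleton hw0] at h
    omega
  unfold polytopeDim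
  rw [← hfin]
  by_contra hdim
  obtain ⟨y, hyP, hyn⟩ := SetLike.exists_of_lt (lt_of_le_of_ne hle fun h => hdim (by rw [h]))
  obtain ⟨f, hfy, hf⟩ := Submodule.exists_le_ker_of_notMem hyn
  obtain ⟨g, hgf⟩ : ∃ g : StrongDual ℝ E, ∀ x, g x = f x := ⟨f.toContinuousLinearMap, fun _ => rfl⟩
  -- up to sign, `g` is somewhere larger than on `G`
  obtain ⟨g, hgy, hgG, hgw, hgpos⟩ : ∃ g : StrongDual ℝ E, g y ≠ 0 ∧
      (∀ u ∈ vectorSpan ℝ G, g u = 0) ∧ g (w - g₀) = 0 ∧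
      ∃ v ∈ P.extremePoints ℝ, g g₀ < g v := by
    have h1 : ∀ u ∈ vectorSpan ℝ G, g u = 0 := fun u hu =>
      (hgf u).trans (hf (Submodule.mem_sup_left hu))
    have h2 : g (w - g₀) = 0 :=
      (hgf _).trans (hf (Submodule.mem_sup_right (Submodule.mem_span_singleton_self _)))
    have h3 : g y ≠ 0 := by rwa [hgf]
    by_cases hex : ∃ v ∈ P.extremePoints ℝ, g g₀ < g v
    · exact ⟨g, h3, h1, h2, hex⟩
    by_cases hex' : ∃ v ∈ P.extremePoints ℝ, g v < g g₀
    · obtain ⟨v, hv, hlt⟩ := hex'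
      exact ⟨-g, by simpa using h3, fun u hu => by simp [h1 u hu], by simp [h2], v, hv,
        by simpa using hlt⟩
    push Not at hex hex'
    have hc : ∀ x ∈ P, g x = g g₀ := by
      rw [← hP.convexHull_extremePoints]
      exact eq_of_mem_convexHull fun v hv => le_antisymm (hex v hv) (hex' v hv)
    refine absurd ((Submodule.span_le (p := g.ker)).2 ?_ hyP) h3
    rintro _ ⟨x, hx, z, hz, rfl⟩
    change g (x - z) = 0
    rw [map_sub, hc x hx, hc z hz, sub_self]
  have hgG' : ∀ x ∈ G, g x = g g₀ := fun x hx => by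
    have := hgG _ (vsub_mem_vectorSpan ℝ hx hg₀)
    rwa [vsub_eq_sub, map_sub, sub_eq_zero] at this
  -- the first vertex met by the rotating hyperplane
  obtain ⟨z, ⟨hzV, hzpos⟩, hzmin⟩ := (hP.finite_extremePoints.subset
    (Set.sep_subset _ fun v => g g₀ < g v)).exists_minimalFor
      (fun v => (c - l v) / (g v - g g₀)) _ hgpos
  set t := (c - l z) / (g z - g g₀) with ht
  have hzpos' : 0 < g z - g g₀ := sub_pos.2 hzpos
  have ht0 : 0 ≤ t := div_nonneg (sub_nonneg.2 (hlc z (hVP z hzV))) hzpos'.le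
  have hbound : ∀ x ∈ P, (l + t • g) x ≤ c + t * g g₀ := by
    have : ∀ v ∈ P.extremePoints ℝ, (l + t • g) v ≤ c + t * g g₀ := by
      intro v hv
      change l v + t * g v ≤ _
      have h1 := hlc v (hVP v hv)
      rcases le_or_gt (g v) (g g₀) with h | h
      · nlinarith
      · have h2 : t ≤ (c - l v) / (g v - g g₀) := by
          by_contra hlt
          exact hlt (hzmin ⟨hv, h⟩ (not_le.1 hlt).le)
        rw [le_div_iff₀ (sub_pos.2 h)] at h2
        linarith
    intro x hx
    rw [← hP.convexHull_extremePoints] at hx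
    exact le_of_mem_convexHull this x hx
  have hGG' : G ⊆ {x ∈ P | (l + t • g) x = c + t * g g₀} := by
    intro x hx
    refine ⟨hGsub hx, ?_⟩
    change l x + t * g x = _
    rw [hgG' x hx, (hlG x (hGsub hx)).2 hx]
  have hzG : z ∈ {x ∈ P | (l + t • g) x = c + t * g g₀} := by
    refine ⟨hVP z hzV, ?_⟩
    change l z + t * g z = _
    have : t * (g z - g g₀) = c - l z := div_mul_cancel₀ _ hzpos'.ne'
    linarith
  have hG'P : {x ∈ P | (l + t • g) x = c + t * g g₀} = P := by
    by_contra hne'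
    exact hzpos.ne' (hgG' z (hmax ⟨isExposed_of_le hbound, hne'⟩ hGG' hzG))
  have hw' : (l + t • g) w = c + t * g g₀ := (hG'P.ge hwP).2
  change l w + t * g w = _ at hw'
  rw [map_sub, sub_eq_zero] at hgw
  rw [map_sub, hl₀] at hlw
  apply hlw
  rw [hgw] at hw'
  linarith

end Faces

/-! ### Affine dependences -/

section AffineDependence

variable {E : Type*} [NormedAddCommGroup E] [NormedSpace ℝ E] {P : Set E} {V : Finset E}
  {f : E → ℝ}

/-- `f` is an affine dependence of the points of `V`; only its values on `V` matter. -/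
structure IsAffineDependence (V : Finset E) (f : E → ℝ) : Prop where
  sum_eq_zero : ∑ v ∈ V, f v = 0
  sum_smul_eq_zero : ∑ v ∈ V, f v • v = 0

namespace IsAffineDependence

/-- An affine dependence is orthogonal to every affine functional. -/
theorem sum_mul (hf : IsAffineDependence V f) (l : StrongDual ℝ E) (c : ℝ) :
    ∑ v ∈ V, f v * (c - l v) = 0 := by
  have h := congrArg l hf.sum_smul_eq_zero
  simp only [map_sum, map_smul, smul_eq_mul, map_zero] at h
  simp only [mul_sub, Finset.sum_sub_distrib, h, ← Finset.sum_mul, hf.sum_eq_zero, zero_mul,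
    sub_zero]

theorem neg (hf : IsAffineDependence V f) : IsAffineDependence V (-f) where
  sum_eq_zero := by simp [hf.sum_eq_zero]
  sum_smul_eq_zero := by simp [hf.sum_smul_eq_zero]

theorem exists_neg (hf : IsAffineDependence V f) (hne : ∃ v ∈ V, f v ≠ 0) :
    ∃ v ∈ V, f v < 0 := by
  by_contra! h
  obtain ⟨v, hv, hv0⟩ := hne
  exact hv0 ((Finset.sum_eq_zero_iff_of_nonneg h).1 hf.sum_eq_zero v hv)

/-- If an affine functional vanishes at all points of the support but `x`, then `f x = 0`. -/
theorem eq_zero_of_functional (hf : IsAffineDependence V f) {x : E} (hx : x ∈ V)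
    {l : StrongDual ℝ E} {c : ℝ} (hl : ∀ v ∈ V, v ≠ x → f v ≠ 0 → l v = c) (hlx : l x ≠ c) :
    f x = 0 := by
  have h := hf.sum_mul l c
  rw [Finset.sum_eq_single_of_mem x hx] at h
  · exact (mul_eq_zero.1 h).resolve_right (sub_ne_zero.2 hlx.symm)
  · intro v hv hvx
    by_cases hfv : f v = 0
    · rw [hfv, zero_mul]
    · rw [hl v hv hvx hfv, sub_self, mul_zero]

/-- A vertex is not a convex combination of other vertices, so an affine dependence of vertices
cannot have exactly one positive entry. -/
theorem nontrivial_pos (hf : IsAffineDependence V f) (hP : Convex ℝ P)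
    (hV : (V : Set E) ⊆ P.extremePoints ℝ) {x : E} (hx : x ∈ V) (hfx : 0 < f x) :
    ∃ y ∈ V, y ≠ x ∧ 0 < f y := by
  classical
  by_contra! h
  have h1 : f x + ∑ v ∈ V.erase x, f v = 0 := by
    rw [Finset.add_sum_erase _ _ hx, hf.sum_eq_zero]
  have h2 : f x • x + ∑ v ∈ V.erase x, f v • v = 0 := by
    rw [Finset.add_sum_erase V (fun v => f v • v) hx, hf.sum_smul_eq_zero]
  have hmem : x ∈ convexHull ℝ ((V.erase x : Finset E) : Set E) := by
    rw [Finset.mem_convexHull']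
    refine ⟨fun v => -f v / f x, fun v hv => ?_, ?_, ?_⟩
    · rw [Finset.mem_erase] at hv
      exact div_nonneg (neg_nonneg.2 (h v hv.2 hv.1)) hfx.le
    · rw [← Finset.sum_div, Finset.sum_neg_distrib, div_eq_one_iff_eq hfx.ne']
      linarith
    · have h3 : ∀ v, (-f v / f x) • v = (-(f x)⁻¹) • f v • v := fun v => by
        rw [smul_smul]
        congr 1
        ring
      simp only [h3, ← Finset.smul_sum]
      rw [eq_neg_of_add_eq_zero_right h2, smul_neg, neg_smul, neg_neg, smul_smul,
        inv_mul_cancel₀ hfx.ne', one_smul]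
  have := mem_of_mem_convexHull_extremePoints hP
    (fun v hv => hV (Finset.erase_subset _ _ hv)) (hV hx) hmem
  simp at this

/-- At most three vertices admit no affine dependence. -/
theorem eq_zero_of_card_le_three (hf : IsAffineDependence V f) (hP : Convex ℝ P)
    (hV : (V : Set E) ⊆ P.extremePoints ℝ) {S : Finset E} (hS : S.card ≤ 3)
    (hfS : ∀ v ∈ V, v ∉ S → f v = 0) : ∀ v ∈ V, f v = 0 := by
  classical
  by_contra! hne
  obtain ⟨a, ha, hfa⟩ := hf.exists_neg hne
  obtain ⟨b, hb, hfb⟩ := hf.neg.exists_neg (by simpa using hne)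
  simp only [Pi.neg_apply, neg_lt_zero] at hfb
  obtain ⟨a', ha', haa', hfa'⟩ := hf.neg.nontrivial_pos hP hV ha (by simpa using hfa)
  simp only [Pi.neg_apply, Left.neg_pos_iff] at hfa'
  obtain ⟨b', hb', hbb', hfb'⟩ := hf.nontrivial_pos hP hV hb hfb
  have hsub : ({a, a', b, b'} : Finset E) ⊆ S := by
    intro v hv
    by_contra hvS
    simp only [Finset.mem_insert, Finset.mem_singleton] at hv
    rcases hv with rfl | rfl | rfl | rfl
    · exact hfa.ne (hfS _ ha hvS)
    · exact hfa'.ne (hfS _ ha' hvS)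
    · exact hfb.ne' (hfS _ hb hvS)
    · exact hfb'.ne' (hfS _ hb' hvS)
  have hcard := Finset.card_le_card hsub
  have hab : ∀ {x y : E}, f x < 0 → 0 < f y → x ≠ y := fun hx hy h => by
    subst h
    exact lt_asymm hx hy
  rw [Finset.card_insert_of_notMem, Finset.card_insert_of_notMem,
    Finset.card_pair hbb'.symm] at hcard
  · omega
  · simp [hab hfa' hfb, hab hfa' hfb']
  · simp [haa'.symm, hab hfa hfb, hab hfa hfb']

end IsAffineDependence

theorem affineIndependent_of_forall_isAffineDependence {W : Finset E} (hWV : W ⊆ V)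
    (h : ∀ f, IsAffineDependence V f → (∀ v ∈ V, v ∉ W → f v = 0) → ∀ v ∈ V, f v = 0) :
    AffineIndependent ℝ (Subtype.val : W → E) := by
  classical
  rw [affineIndependent_iff]
  intro s w hw hws x hx
  obtain ⟨g, hg, hg'⟩ : ∃ g : E → ℝ, (∀ y ∈ s, g y = w y) ∧
      ∀ v ∉ s.map (Function.Embedding.subtype _), g v = 0 := by
    refine ⟨fun v => if hv : v ∈ W then (if (⟨v, hv⟩ : W) ∈ s then w ⟨v, hv⟩ else 0) else 0,
      fun y hy => by simp [hy], fun v hv => ?_⟩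
    dsimp only
    split_ifs with h1 h2
    · exact absurd (Finset.mem_map.2 ⟨_, h2, rfl⟩) hv
    · rfl
    · rfl
  have hsub : s.map (Function.Embedding.subtype _) ⊆ W := fun v hv => by
    simp only [Finset.mem_map, Function.Embedding.subtype_apply] at hv
    obtain ⟨y, -, rfl⟩ := hv
    exact y.2
  rw [← hg x hx]
  refine h g ⟨?_, ?_⟩ (fun v _ hv => hg' v fun hv' => hv (hsub hv')) x (hWV x.2)
  · rw [← Finset.sum_subset (hsub.trans hWV) fun v _ hv => hg' v hv, Finset.sum_map, ← hw]
    exact Finset.sum_congr rfl hg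
  · rw [← Finset.sum_subset (hsub.trans hWV) fun v _ hv => by rw [hg' v hv, zero_smul],
      Finset.sum_map, ← hws]
    exact Finset.sum_congr rfl fun y hy => congrArg (· • (y : E)) (hg y hy)

/-- If the proper subset `S` of the vertices lies in no proper face, then the affine hull of `S`
meets the convex hull of the other vertices; a common point gives an affine dependence whose
positive entries lie in `S`. -/
theorem exists_isAffineDependence_nonpos_off [FiniteDimensional ℝ E] (hP : IsPolytope P)
    (hV : (V : Set E) = P.extremePoints ℝ) {S : Finset E} (hSV : S ⊂ V) (hS : S.Nonempty)
    (hspan : ∀ G, IsExposed ℝ P G → (S : Set E) ⊆ G → G = P) :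
    ∃ f, IsAffineDependence V f ∧ (∀ v ∈ V, v ∉ S → f v ≤ 0) ∧ ∃ v ∈ V, f v ≠ 0 := by
  classical
  have hnd : ¬ Disjoint (convexHull ℝ ((V \ S : Finset E) : Set E))
      (affineSpan ℝ (S : Set E) : Set E) := by
    intro hd
    obtain ⟨l, c, hlS, hlV⟩ := exists_dual_eq_of_disjoint_affineSpan (Finset.coe_nonempty.2 hS)
      ((V \ S).finite_toSet.isCompact_convexHull ℝ) (convex_convexHull ℝ _) hd
    have hlV' : ∀ v ∈ V, v ∉ S → l v < c := fun v hv hvS =>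
      hlV v (subset_convexHull ℝ _ (by simp [hv, hvS]))
    have hle : ∀ x ∈ P, l x ≤ c := by
      rw [← hP.convexHull_extremePoints, ← hV]
      refine le_of_mem_convexHull fun v hv => ?_
      by_cases hvS : v ∈ S
      · exact (hlS v hvS).le
      · exact (hlV' v hv hvS).le
    have hVP : ∀ v ∈ V, v ∈ P := fun v hv => extremePoints_subset (𝕜 := ℝ) (hV ▸ hv)
    have hG := hspan _ (isExposed_of_le hle) fun v hv => ⟨hVP v (hSV.1 hv), hlS v hv⟩
    obtain ⟨v, hv, hvS⟩ := Finset.exists_of_ssubset hSV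
    exact (hlV' v hv hvS).ne (hG.ge (hVP v hv)).2
  obtain ⟨y, hyV, hyS⟩ := Set.not_disjoint_iff.1 hnd
  obtain ⟨b, hb0, hb1, hby⟩ := Finset.mem_convexHull'.1 hyV
  have hyS' : y ∈ affineSpan ℝ (Set.range (Subtype.val : S → E)) := by
    simpa using hyS
  obtain ⟨a, ha1, hay⟩ := eq_affineCombination_of_mem_affineSpan_of_fintype hyS'
  rw [Finset.affineCombination_eq_linear_combination _ _ _ ha1] at hay
  obtain ⟨g, hg, hg'⟩ : ∃ g : E → ℝ, (∀ x : S, g x = a x) ∧ ∀ v ∈ V \ S, g v = -b v :=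
    ⟨fun v => if hv : v ∈ S then a ⟨v, hv⟩ else -b v, fun x => by simp,
      fun v hv => dif_neg (Finset.mem_sdiff.1 hv).2⟩
  refine ⟨g, ⟨?_, ?_⟩, fun v hv hvS => ?_, ?_⟩
  · rw [← Finset.sum_sdiff hSV.1, Finset.sum_congr rfl hg', ← Finset.sum_coe_sort S,
      Finset.sum_congr rfl fun x _ => hg x, ha1, Finset.sum_neg_distrib, hb1]
    norm_num
  · rw [← Finset.sum_sdiff hSV.1, Finset.sum_congr rfl fun v hv => congrArg (· • v) (hg' v hv),
      ← Finset.sum_coe_sort S,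
      Finset.sum_congr rfl fun (x : S) _ => congrArg (· • (x : E)) (hg x)]
    simp only [neg_smul, Finset.sum_neg_distrib]
    rw [hby, ← hay, neg_add_cancel]
  · have hv' : v ∈ V \ S := Finset.mem_sdiff.2 ⟨hv, hvS⟩
    rw [hg' v hv']
    exact neg_nonpos.2 (hb0 v hv')
  · by_contra! h
    refine one_ne_zero (α := ℝ) (hb1.symm.trans (Finset.sum_eq_zero fun v hv => ?_))
    have := h v (Finset.sdiff_subset hv)
    rw [hg' v hv] at this
    linarith

/-- In a `k`-neighborly polytope with more than `k` vertices, every affine dependence of the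
vertices has more than `k` positive entries: otherwise the positive entries, but not all negative
ones, would lie on a face. -/
theorem IsKNeighborly.lt_card_pos {k : ℕ} (hP : IsPolytope P) (hk : IsKNeighborly k P)
    (hV : (V : Set E) = P.extremePoints ℝ) (hcard : k < V.card) (hf : IsAffineDependence V f)
    (hne : ∃ v ∈ V, f v ≠ 0) {S : Finset E} (hS : ∀ v ∈ V, 0 < f v → v ∈ S) : k < S.card := by
  classical
  by_contra! hle
  obtain ⟨z, hz, hfz⟩ := hf.exists_neg hne
  obtain ⟨T, hST, hTV, hTk⟩ := Finset.exists_subsuperset_card_eq (s := V.filter (0 < f ·))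
    (t := V.erase z) (n := k) (fun v hv => by
      rw [Finset.mem_filter] at hv
      exact Finset.mem_erase.2 ⟨fun h => lt_asymm hfz (h ▸ hv.2), hv.1⟩)
    ((Finset.card_le_card fun v hv => by
      rw [Finset.mem_filter] at hv
      exact hS v hv.1 hv.2).trans hle) (by rw [Finset.card_erase_of_mem hz]; omega)
  have hTV' : (T : Set E) ⊆ P.extremePoints ℝ := fun v hv => hV ▸ Finset.erase_subset _ _ (hTV hv)
  obtain ⟨l, c, hle, hl⟩ := (hk T hTV' hTk).exists_support
  have hVP : ∀ v ∈ V, v ∈ P := fun v hv => extremePoints_subset (𝕜 := ℝ) (hV ▸ hv)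
  refine absurd (hf.sum_mul l c) (ne_of_lt (Finset.sum_neg' (fun v hv => ?_) ⟨z, hz, ?_⟩))
  · rcases le_or_gt (f v) 0 with h | h
    · exact mul_nonpos_of_nonpos_of_nonneg h (sub_nonneg.2 (hle v (hVP v hv)))
    · have hvT : v ∈ T := hST (Finset.mem_filter.2 ⟨hv, h⟩)
      rw [(hl v (hVP v hv)).2 (subset_convexHull ℝ _ hvT), sub_self, mul_zero]
  · refine mul_neg_of_neg_of_pos hfz (sub_pos.2 (lt_of_le_of_ne (hle z (hVP z hz)) fun h => ?_))
    have hzT := mem_of_mem_convexHull_extremePoints hP.convex hTV' (hV ▸ hz)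
      ((hl z (hVP z hz)).1 h)
    exact (Finset.mem_erase.1 (hTV hzT)).1 rfl

theorem IsPolytope.polytopeDim_lt_card (hP : IsPolytope P)
    (hV : (V : Set E) = P.extremePoints ℝ) (hne : V.Nonempty) : polytopeDim P < V.card := by
  have h1 : vectorSpan ℝ P = vectorSpan ℝ (Set.range (Subtype.val : V → E)) := by
    rw [← hP.convexHull_extremePoints, ← hV, ← direction_affineSpan, affineSpan_convexHull,
      direction_affineSpan]
    simp
  have hpos := Finset.card_pos.2 hne
  have h2 := finrank_vectorSpan_range_le ℝ (Subtype.val : V → E) (n := V.card - 1)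
    (by rw [Fintype.card_coe]; omega)
  unfold polytopeDim
  rw [h1]
  omega

end AffineDependence

/-! ### Combinatorics of the special polytope -/

/-- The minimal non-faces of the special polytope: the vertex sets of the three segments and of the
triangle of which it is the free sum. -/
def specialNonfaces : Finset (Finset ℕ) :=
  {{1, 6}, {2, 4}, {3, 5}, {7, 8, 9}}

theorem specialNonfaces_subset : ∀ C ∈ specialNonfaces, C ⊆ Finset.Icc 1 9 := by decide

theorem specialFacets_subset : ∀ T ∈ specialFacets, T ⊆ Finset.Icc 1 9 := by decide

theorem specialFacets_card : ∀ T ∈ specialFacets, T.card = 5 := by decide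

theorem not_specialNonface_subset_specialFacet :
    ∀ C ∈ specialNonfaces, ∀ T ∈ specialFacets, ¬ C ⊆ T := by decide

/-- Every facet has a neighbor across each of its ridges. -/
theorem exists_specialFacet_erase_subset :
    ∀ T ∈ specialFacets, ∀ t ∈ T, ∃ T' ∈ specialFacets, t ∉ T' ∧ T.erase t ⊆ T' := by decide

/-- The facets are the complements of the transversals of the minimal non-faces. -/
theorem exists_specialFacet_eq_sdiff : ∀ a ∈ ({1, 6} : Finset ℕ), ∀ b ∈ ({2, 4} : Finset ℕ),
    ∀ c ∈ ({3, 5} : Finset ℕ), ∀ d ∈ ({7, 8, 9} : Finset ℕ),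
    Finset.Icc 1 9 \ {a, b, c, d} ∈ specialFacets := by decide

theorem exists_specialFacet_superset {S : Finset ℕ} (hS : S ⊆ Finset.Icc 1 9)
    (h : ∀ C ∈ specialNonfaces, ¬ C ⊆ S) : ∃ T ∈ specialFacets, S ⊆ T := by
  have h' : ∀ C ∈ specialNonfaces, ∃ i ∈ C, i ∉ S := fun C hC => Finset.not_subset.1 (h C hC)
  obtain ⟨a, ha, haS⟩ := h' {1, 6} (by decide)
  obtain ⟨b, hb, hbS⟩ := h' {2, 4} (by decide)
  obtain ⟨c, hc, hcS⟩ := h' {3, 5} (by decide)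
  obtain ⟨d, hd, hdS⟩ := h' {7, 8, 9} (by decide)
  refine ⟨_, exists_specialFacet_eq_sdiff a ha b hb c hc d hd, fun i hi => ?_⟩
  simp only [Finset.mem_sdiff, Finset.mem_insert, Finset.mem_singleton, not_or]
  exact ⟨hS hi, fun e => haS (e ▸ hi), fun e => hbS (e ▸ hi), fun e => hcS (e ▸ hi),
    fun e => hdS (e ▸ hi)⟩

/-! ### Quotients isomorphic to the special polytope -/

section Quotient

variable {E E' : Type*} [NormedAddCommGroup E] [NormedSpace ℝ E] [FiniteDimensional ℝ E]
  [NormedAddCommGroup E'] [NormedSpace ℝ E']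

theorem IsPolytope.isExposed_singleton {P : Set E} (hP : IsPolytope P) {v : E}
    (hv : v ∈ P.extremePoints ℝ) : IsExposed ℝ P {v} := by
  have hfin : (P.extremePoints ℝ \ {v}).Finite := hP.finite_extremePoints.sdiff
  obtain ⟨l, c, hlv, hl⟩ := exists_dual_eq_of_disjoint_affineSpan (Set.singleton_nonempty v)
    (hfin.isCompact_convexHull ℝ) (convex_convexHull ℝ (P.extremePoints ℝ \ {v})) (by
      rw [AffineSubspace.coe_affineSpan_singleton, Set.disjoint_singleton_right]
      exact fun h => (mem_of_mem_convexHull_extremePoints hP.convex Set.sdiff_subset hv h).2 rfl)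
  have hlv' : l v = c := hlv v rfl
  have hl' : ∀ w ∈ P.extremePoints ℝ, w ≠ v → l w < c := fun w hw hwv =>
    hl w (subset_convexHull ℝ _ ⟨hw, hwv⟩)
  have hle : ∀ x ∈ P, l x ≤ c := by
    rw [← hP.convexHull_extremePoints]
    refine le_of_mem_convexHull fun w hw => ?_
    by_cases hwv : w = v
    · rw [hwv, hlv']
    · exact (hl' w hw hwv).le
  have hG := hP.convexHull_extremePoints_inter (isExposed_of_le hle)
  have : P.extremePoints ℝ ∩ {x ∈ P | l x = c} = {v} := by
    ext w
    constructor
    · rintro ⟨hw, -, hwc⟩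
      by_contra hwv
      exact (hl' w hw hwv).ne hwc
    · rintro rfl
      exact ⟨hv, extremePoints_subset hv, hlv'⟩
  rw [this, convexHull_singleton] at hG
  rw [hG]
  exact isExposed_of_le hle

/-- The faces of `Q` containing the face `F` form the face lattice of the special polytope. Here
`q i` is a vertex of `Q` outside `F` chosen on the face that corresponds to the vertex `i`. -/
structure IsSpecialQuotient (Q F : Set E') (q : ℕ → E') : Prop where
  isExposed : IsExposed ℝ Q F
  mem_extremePoints : ∀ i ∈ Finset.Icc 1 9, q i ∈ Q.extremePoints ℝ
  notMem : ∀ i ∈ Finset.Icc 1 9, q i ∉ F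
  injOn : Set.InjOn q (Finset.Icc 1 9 : Finset ℕ)
  exists_mem : ∀ G, IsExposed ℝ Q G → F ⊂ G → ∃ i ∈ Finset.Icc 1 9, q i ∈ G
  eq_of_nonface : ∀ C ∈ specialNonfaces, ∀ G, IsExposed ℝ Q G → F ⊆ G →
    (∀ i ∈ C, q i ∈ G) → G = Q
  exists_face : ∀ T ∈ specialFacets, ∃ G, IsExposed ℝ Q G ∧ F ⊆ G ∧
    ∀ i ∈ Finset.Icc 1 9, q i ∈ G ↔ i ∈ T

theorem IsSpecialPolytope.exists_isSpecialQuotient {P : Set E} {Q : Set E'}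
    (hP : IsSpecialPolytope P) (hQ : IsPolytope Q) (hPQ : IsQuotientOf P Q) :
    ∃ F q, IsSpecialQuotient Q F q := by
  obtain ⟨hP, hdim, v, hv, hfac⟩ := hP
  obtain ⟨⟨F, hF⟩, ⟨e⟩⟩ := hPQ
  have hIcc : ∀ i, i ∈ Finset.Icc 1 9 → i ∈ Set.Icc 1 9 := fun i hi => by simpa using hi
  have hvP : ∀ i ∈ Finset.Icc 1 9, v i ∈ P.extremePoints ℝ := fun i hi => hv.mapsTo (hIcc i hi)
  have hfacet : ∀ T ∈ specialFacets, IsPolytopeFacet P (convexHull ℝ (v '' (T : Set ℕ))) :=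
    fun T hT => hfac.ge ⟨T, hT, rfl⟩
  have hmem : ∀ T ∈ specialFacets, ∀ i ∈ Finset.Icc 1 9,
      v i ∈ convexHull ℝ (v '' (T : Set ℕ)) ↔ i ∈ T := by
    intro T hT i hi
    refine ⟨fun h => ?_, fun h => subset_convexHull ℝ _ ⟨i, h, rfl⟩⟩
    obtain ⟨j, hj, hji⟩ := mem_of_mem_convexHull_extremePoints hP.convex (by
      rintro _ ⟨j, hj, rfl⟩
      exact hvP j (specialFacets_subset T hT hj)) (hvP i hi) h
    rwa [← hv.injOn (hIcc j (specialFacets_subset T hT hj)) (hIcc i hi) hji]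
  have hnonface : ∀ C ∈ specialNonfaces, ∀ A, IsExposed ℝ P A → (∀ i ∈ C, v i ∈ A) → A = P := by
    intro C hC A hA hCA
    by_contra hne
    have hCne : C.Nonempty := (by decide : ∀ C ∈ specialNonfaces, C.Nonempty) C hC
    obtain ⟨i, hi⟩ := hCne
    obtain ⟨G, hG, hAG⟩ := hP.exists_facet hA ⟨_, hCA i hi⟩ hne
    obtain ⟨T, hT, rfl⟩ := hfac.le hG
    exact not_specialNonface_subset_specialFacet C hC T hT fun j hj =>
      (hmem T hT j (specialNonfaces_subset C hC hj)).1 (hAG (hCA j hj))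
  -- the isomorphism, written in terms of sets
  obtain ⟨φ, hφe, hφF, hφsurj, hφmono, hφempty, hφP⟩ : ∃ φ : PolytopeFace P → Set E',
      (∀ A, IsExposed ℝ Q (φ A)) ∧ (∀ A, F ⊆ φ A) ∧
      (∀ G, IsExposed ℝ Q G → F ⊆ G → ∃ A, φ A = G) ∧
      (∀ A B, φ A ⊆ φ B ↔ A.1 ⊆ B.1) ∧ φ ⟨∅, isExposed_empty⟩ = F ∧
      φ ⟨P, IsExposed.refl P⟩ = Q := by
    have hmono : ∀ A B, (e A).1.1 ⊆ (e B).1.1 ↔ A.1 ⊆ B.1 := fun A B => e.le_iff_le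
    have hsurj : ∀ G, IsExposed ℝ Q G → F ⊆ G → ∃ A, (e A).1.1 = G := fun G hG hFG =>
      ⟨e.symm ⟨⟨G, hG⟩, hFG⟩, by rw [e.apply_symm_apply]⟩
    refine ⟨fun A => (e A).1.1, fun A => (e A).1.2, fun A => (e A).2, hsurj, hmono, ?_, ?_⟩
    · obtain ⟨A, hA⟩ := hsurj F hF subset_rfl
      refine (((hmono _ A).2 (Set.empty_subset _)).trans hA.le).antisymm (e _).2
    · obtain ⟨A, hA⟩ := hsurj Q (IsExposed.refl Q) hF.subset
      exact (e _).1.2.subset.antisymm (hA.ge.trans ((hmono A _).2 A.2.subset))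
  have hatom : ∀ i : ℕ, ∃ x, ∀ hi : i ∈ Finset.Icc 1 9, x ∈ Q.extremePoints ℝ ∧ x ∉ F ∧
      x ∈ φ ⟨{v i}, hP.isExposed_singleton (hvP i hi)⟩ := by
    intro i
    by_cases hi : i ∈ Finset.Icc 1 9
    · by_contra! h
      have hsub := hQ.face_subset_of_extremePoints
        (hφe ⟨{v i}, hP.isExposed_singleton (hvP i hi)⟩) hF fun x hx hxi => by
          by_contra hxF
          obtain ⟨_, hx'⟩ := h x
          exact hx' hx hxF hxi
      rw [← hφempty, hφmono] at hsub
      exact hsub rfl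
    · exact ⟨0, fun h => absurd h hi⟩
  choose q hq using hatom
  have hqmem : ∀ i ∈ Finset.Icc 1 9, ∀ A, q i ∈ φ A ↔ v i ∈ A.1 := by
    intro i hi A
    obtain ⟨hqV, hqF, hqi⟩ := hq i hi
    constructor
    · intro hqA
      obtain ⟨B, hB⟩ := hφsurj _ ((hφe A).inter (hφe _))
        (Set.subset_inter (hφF A) (hφF ⟨{v i}, hP.isExposed_singleton (hvP i hi)⟩))
      have hBA : B.1 ⊆ A.1 := (hφmono B A).1 (hB.le.trans Set.inter_subset_left)
      have hBi : B.1 ⊆ {v i} := (hφmono B _).1 (hB.le.trans Set.inter_subset_right)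
      rcases Set.subset_singleton_iff_eq.1 hBi with h | h
      · have hB0 : B = ⟨∅, isExposed_empty⟩ := Subtype.ext h
        rw [hB0, hφempty] at hB
        exact absurd (hB.ge ⟨hqA, hqi⟩) hqF
      · exact hBA (h.ge rfl)
    · intro hvA
      exact (hφmono _ A).2 (Set.singleton_subset_iff.2 hvA) hqi
  refine ⟨F, q, hF, fun i hi => (hq i hi).1, fun i hi => (hq i hi).2.1, ?_, ?_, ?_, ?_⟩
  · intro i hi j hj hij
    have h := (hq i hi).2.2
    rw [hij, hqmem j hj] at h
    exact (hv.injOn (hIcc j hj) (hIcc i hi) h).symm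
  · intro G hG hFG
    obtain ⟨A, rfl⟩ := hφsurj G hG hFG.1
    by_contra! h
    refine hFG.2 (?_ : φ A ⊆ F)
    rw [← hφempty, hφmono]
    refine hP.face_subset_of_extremePoints A.2 isExposed_empty fun x hx hxA => ?_
    obtain ⟨i, hi, rfl⟩ := hv.surjOn hx
    have hi' : i ∈ Finset.Icc 1 9 := by simpa using hi
    exact h i hi' ((hqmem i hi' A).2 hxA)
  · intro C hC G hG hFG hCG
    obtain ⟨A, rfl⟩ := hφsurj G hG hFG
    have hA : A = ⟨P, IsExposed.refl P⟩ := Subtype.ext (hnonface C hC A.1 A.2 fun i hi =>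
      (hqmem i (specialNonfaces_subset C hC hi) A).1 (hCG i hi))
    rw [hA, hφP]
  · intro T hT
    exact ⟨φ ⟨_, (hfacet T hT).1⟩, hφe _, hφF _, fun i hi =>
      (hqmem i hi _).trans (hmem T hT i hi)⟩

end Quotient

/-! ### Neighborly polytopes with the special polytope as a quotient -/

section Bound

open Finset

variable {E : Type*} [NormedAddCommGroup E] [NormedSpace ℝ E] {Q F : Set E} {q : ℕ → E}
  {V VF : Finset E}

namespace IsSpecialQuotient

theorem mem_vertices (h : IsSpecialQuotient Q F q) (hV : (V : Set E) = Q.extremePoints ℝ) :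
    ∀ i ∈ Icc 1 9, q i ∈ V := fun i hi => mem_coe.1 (hV ▸ h.mem_extremePoints i hi)

theorem card_add_nine_le [DecidableEq E] (h : IsSpecialQuotient Q F q)
    (hV : (V : Set E) = Q.extremePoints ℝ) (hVF : ∀ x, x ∈ VF ↔ x ∈ V ∧ x ∈ F) :
    VF.card + 9 ≤ V.card := by
  have hd : Disjoint VF ((Icc 1 9).image q) := by
    rw [disjoint_left]
    intro x hx hxq
    obtain ⟨i, hi, rfl⟩ := mem_image.1 hxq
    exact h.notMem i hi ((hVF _).1 hx).2
  have hsub : VF ∪ (Icc 1 9).image q ⊆ V := by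
    refine union_subset (fun x hx => ((hVF x).1 hx).1) fun x hx => ?_
    obtain ⟨i, hi, rfl⟩ := mem_image.1 hx
    exact h.mem_vertices hV i hi
  have := card_le_card hsub
  rwa [card_union_of_disjoint hd, card_image_of_injOn h.injOn, Nat.card_Icc] at this

/-- If `F` has at most three vertices, then its vertices, those chosen on a facet `T` of the
quotient, and one more chosen vertex are affinely independent. A dependence vanishes at the last
vertex since `T` is a face, on `T` since every `T.erase t` lies on a neighboring facet, and then on
`F`. -/
theorem affineIndependent [DecidableEq E] (h : IsSpecialQuotient Q F q) (hQ : IsPolytope Q)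
    (hV : (V : Set E) = Q.extremePoints ℝ) (hVF : ∀ x, x ∈ VF ↔ x ∈ V ∧ x ∈ F)
    (hcard : VF.card ≤ 3) {T : Finset ℕ} (hT : T ∈ specialFacets) {j : ℕ} (hj : j ∈ Icc 1 9)
    (hjT : j ∉ T) :
    AffineIndependent ℝ (Subtype.val : ↥(insert (q j) (VF ∪ T.image q)) → E) := by
  have hTI := specialFacets_subset T hT
  have hVQ : ∀ v ∈ V, v ∈ Q := fun v hv => extremePoints_subset (𝕜 := ℝ) (hV ▸ hv)
  refine affineIndependent_of_forall_isAffineDependence (V := V) ?_ fun f hf hfW => ?_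
  · intro x hx
    simp only [mem_insert, mem_union, mem_image] at hx
    rcases hx with rfl | hx | ⟨i, hi, rfl⟩
    · exact h.mem_vertices hV j hj
    · exact ((hVF x).1 hx).1
    · exact h.mem_vertices hV i (hTI hi)
  have hsupp : ∀ v ∈ V, f v ≠ 0 → v = q j ∨ v ∈ F ∨ ∃ i ∈ T, q i = v := by
    intro v hv hfv
    by_contra hcon
    refine hfv (hfW v hv fun hvW => hcon ?_)
    simp only [mem_insert, mem_union, mem_image] at hvW
    exact hvW.imp_right (Or.imp_left fun h => ((hVF v).1 h).2)
  have hfj : f (q j) = 0 := by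
    obtain ⟨G, hG, hFG, hqG⟩ := h.exists_face T hT
    obtain ⟨l, c, -, hl⟩ := hG.exists_support
    refine hf.eq_zero_of_functional (h.mem_vertices hV j hj) (l := l) (c := c) ?_ ?_
    · intro v hv hvj hfv
      refine (hl v (hVQ v hv)).2 ?_
      rcases hsupp v hv hfv with rfl | hvF | ⟨i, hi, rfl⟩
      · exact absurd rfl hvj
      · exact hFG hvF
      · exact (hqG i (hTI hi)).2 hi
    · exact fun hc => hjT ((hqG j hj).1 ((hl _ (hVQ _ (h.mem_vertices hV j hj))).1 hc))
  have hft : ∀ t ∈ T, f (q t) = 0 := by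
    intro t ht
    obtain ⟨T', hT', htT', hTT'⟩ := exists_specialFacet_erase_subset T hT t ht
    obtain ⟨G, hG, hFG, hqG⟩ := h.exists_face T' hT'
    obtain ⟨l, c, -, hl⟩ := hG.exists_support
    have htI := hTI ht
    refine hf.eq_zero_of_functional (h.mem_vertices hV t htI) (l := l) (c := c) ?_ ?_
    · intro v hv hvt hfv
      refine (hl v (hVQ v hv)).2 ?_
      rcases hsupp v hv hfv with rfl | hvF | ⟨i, hi, rfl⟩
      · exact absurd hfj hfv
      · exact hFG hvF
      · exact (hqG i (hTI hi)).2 (hTT' (mem_erase.2 ⟨fun e => hvt (e ▸ rfl), hi⟩))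
    · exact fun hc => htT' ((hqG t htI).1 ((hl _ (hVQ _ (h.mem_vertices hV t htI))).1 hc))
  refine hf.eq_zero_of_card_le_three hQ.convex hV.le hcard fun v hv hvF => ?_
  by_contra hfv
  rcases hsupp v hv hfv with rfl | hvF' | ⟨i, hi, rfl⟩
  · exact hfv hfj
  · exact hvF ((hVF v).2 ⟨hv, hvF'⟩)
  · exact hfv (hft i hi)

theorem card_add_five_le_polytopeDim [FiniteDimensional ℝ E]
    (h : IsSpecialQuotient Q F q) (hQ : IsPolytope Q) (hV : (V : Set E) = Q.extremePoints ℝ)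
    (hVF : ∀ x, x ∈ VF ↔ x ∈ V ∧ x ∈ F) (hcard : VF.card ≤ 3) :
    VF.card + 5 ≤ polytopeDim Q := by
  classical
  have hT : ({1, 2, 3, 7, 8} : Finset ℕ) ∈ specialFacets := by decide
  have h4T : 4 ∉ ({1, 2, 3, 7, 8} : Finset ℕ) := by decide
  set T : Finset ℕ := {1, 2, 3, 7, 8}
  have hind := h.affineIndependent hQ hV hVF hcard hT (j := 4) (by decide) h4T
  have hTI := specialFacets_subset T hT
  have h1 : (insert (q 4) (VF ∪ T.image q)).card = VF.card + 5 + 1 := by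
    rw [card_insert_of_notMem, card_union_of_disjoint, card_image_of_injOn
      (h.injOn.mono (coe_subset.2 hTI)), specialFacets_card T hT]
    · rw [disjoint_left]
      intro x hx hxq
      obtain ⟨i, hi, rfl⟩ := mem_image.1 hxq
      exact h.notMem i (hTI hi) ((hVF _).1 hx).2
    · intro hmem
      rcases mem_union.1 hmem with hmem | hmem
      · exact h.notMem 4 (by decide) ((hVF _).1 hmem).2
      · obtain ⟨i, hi, e⟩ := mem_image.1 hmem
        exact h4T (h.injOn (hTI hi) (by decide : 4 ∈ Icc 1 9) e ▸ hi)
  have h2 := hind.finrank_vectorSpan (n := VF.card + 5) (by rw [Fintype.card_coe, h1])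
  rw [← h2]
  refine Submodule.finrank_mono (vectorSpan_mono ℝ ?_)
  rintro _ ⟨⟨x, hx⟩, rfl⟩
  have hVQ : ∀ v ∈ V, v ∈ Q := fun v hv => extremePoints_subset (𝕜 := ℝ) (hV ▸ hv)
  apply hVQ
  simp only [mem_insert, mem_union, mem_image] at hx
  rcases hx with rfl | hx | ⟨i, hi, rfl⟩
  · exact h.mem_vertices hV 4 (by decide)
  · exact ((hVF x).1 hx).1
  · exact h.mem_vertices hV i (hTI hi)

/-- The dependences of the four minimal non-faces are not all positive at a vertex `a` of `F`. In
the Gale dual, the vector of `a` lies in one of the four cones spanned by three of the vectors of a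
transversal of the minimal non-faces, and then the dependence of the remaining non-face is not
positive at `a`. The coordinates of `a` in this cone are the values of an affine functional. -/
theorem false_of_dependences [FiniteDimensional ℝ E] [DecidableEq E]
    (h : IsSpecialQuotient Q F q) (hQ : IsPolytope Q)
    (hV : (V : Set E) = Q.extremePoints ℝ) (hVF : ∀ x, x ∈ VF ↔ x ∈ V ∧ x ∈ F)
    (hcard : VF.card ≤ 3) (hVq : ∀ v ∈ V, v ∈ F ∨ ∃ i ∈ Icc 1 9, q i = v) {a : E}
    (ha : a ∈ VF)
    (hf : ∀ C ∈ specialNonfaces, ∃ f, IsAffineDependence V f ∧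
      (∀ v ∈ V, v ∉ VF ∪ C.image q → f v ≤ 0) ∧ 0 < f a) : False := by
  have hVQ : ∀ v ∈ V, v ∈ Q := fun v hv => extremePoints_subset (𝕜 := ℝ) (hV ▸ hv)
  have hT : ({1, 2, 3, 7, 8} : Finset ℕ) ∈ specialFacets := by decide
  have hpart : ∀ i ∈ Icc 1 9, i ∈ ({1, 2, 3, 7, 8} : Finset ℕ) ∨ i ∈ ({4, 5, 6, 9} : Finset ℕ) := by
    decide
  have hpart' : ∀ i ∈ ({4, 5, 6, 9} : Finset ℕ), i ∈ Icc 1 9 ∧ i ∉ ({1, 2, 3, 7, 8} : Finset ℕ) := by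
    decide
  set T : Finset ℕ := {1, 2, 3, 7, 8} with hTdef
  set N : Finset ℕ := {4, 5, 6, 9} with hNdef
  have hTI := specialFacets_subset T hT
  obtain ⟨haV, haF⟩ := (hVF a).1 ha
  -- `l₀ - c₀` vanishes on all vertices of `F` and `T` but `a`, where it is negative
  obtain ⟨l₀, c₀, hl₀, hl₀a⟩ : ∃ (l : StrongDual ℝ E) (c : ℝ),
      (∀ x ∈ (VF ∪ T.image q).erase a, l x = c) ∧ l a < c := by
    have hind := (h.affineIndependent hQ hV hVF hcard hT (j := 4) (by decide)
      (by decide)).mono (s := ((VF ∪ T.image q : Finset E) : Set E)) (subset_insert _ _)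
    have hna : a ∉ affineSpan ℝ (((VF ∪ T.image q).erase a : Finset E) : Set E) := by
      have := hind.notMem_affineSpan_sdiff ⟨a, mem_union_left _ ha⟩ Set.univ
      convert this using 3
      ext x
      simp
      tauto
    obtain ⟨l, c, hl, hla⟩ := exists_dual_eq_of_disjoint_affineSpan
      (S := (((VF ∪ T.image q).erase a : Finset E) : Set E)) (K := {a})
      ⟨q 1, by
        refine mem_coe.2 (mem_erase.2 ⟨?_, mem_union_right _ (mem_image_of_mem q (by decide))⟩)
        exact fun e => h.notMem 1 (by decide) (e ▸ haF)⟩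
      isCompact_singleton (convex_singleton a) (Set.disjoint_singleton_left.2 hna)
    exact ⟨l, c, hl, hla a rfl⟩
  obtain ⟨G, hG, hFG, hqG⟩ := h.exists_face T hT
  obtain ⟨l, c, hlc, hl⟩ := hG.exists_support
  have hlF : ∀ v ∈ V, v ∈ F → l v = c := fun v hv hvF => (hl v (hVQ v hv)).2 (hFG hvF)
  have hlT : ∀ i ∈ T, l (q i) = c := fun i hi =>
    (hl _ (hVQ _ (h.mem_vertices hV i (hTI hi)))).2 ((hqG i (hTI hi)).2 hi)
  have hlN : ∀ i ∈ N, 0 < c - l (q i) := fun i hi => by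
    obtain ⟨hiI, hiT⟩ := hpart' i hi
    have hiQ := hVQ _ (h.mem_vertices hV i hiI)
    exact sub_pos.2 (lt_of_le_of_ne (hlc _ hiQ) fun e => hiT ((hqG i hiI).1 ((hl _ hiQ).1 e)))
  -- add the least multiple of the facet functional that makes all values on `N` nonnegative
  obtain ⟨j, hjN, hj⟩ := N.exists_max_image (fun i => (c₀ - l₀ (q i)) / (c - l (q i)))
    ⟨4, by decide⟩
  set t := (c₀ - l₀ (q j)) / (c - l (q j)) with ht
  have hcover : ∀ j ∈ ({4, 5, 6, 9} : Finset ℕ), ∃ C ∈ specialNonfaces,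
      ∀ i ∈ ({4, 5, 6, 9} : Finset ℕ), i ∈ C → i = j := by decide
  obtain ⟨C, hC, hCj⟩ := hcover j hjN
  obtain ⟨f, hfd, hfC, hfa⟩ := hf C hC
  have hsum : ∑ v ∈ V, f v * ((c₀ - l₀ v) - t * (c - l v)) = 0 := by
    have h1 : ∀ v, f v * ((c₀ - l₀ v) - t * (c - l v))
        = f v * (c₀ - l₀ v) - t * (f v * (c - l v)) := fun v => by ring
    simp only [h1, sum_sub_distrib, ← mul_sum, hfd.sum_mul, mul_zero, sub_zero]
  refine absurd hsum (ne_of_gt (sum_pos' (fun v hv => ?_) ⟨a, haV, ?_⟩))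
  · rcases hVq v hv with hvF | ⟨i, hi, rfl⟩
    · by_cases hva : v = a
      · subst hva
        rw [hlF v hv hvF, sub_self, mul_zero, sub_zero]
        exact mul_nonneg hfa.le (sub_nonneg.2 hl₀a.le)
      · rw [hlF v hv hvF, hl₀ v (mem_erase.2 ⟨hva, mem_union_left _ ((hVF v).2 ⟨hv, hvF⟩)⟩)]
        simp
    · have hqa : q i ≠ a := fun e => h.notMem i hi (e ▸ haF)
      rcases hpart i hi with hiT | hiN
      · rw [hlT i hiT, hl₀ _ (mem_erase.2 ⟨hqa, mem_union_right _ (mem_image_of_mem q hiT)⟩)]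
        simp
      · by_cases hij : i = j
        · subst hij
          rw [ht, div_mul_cancel₀ _ (hlN i hiN).ne', sub_self, mul_zero]
        · refine mul_nonneg_of_nonpos_of_nonpos (hfC _ hv fun hmem => ?_) ?_
          · rcases mem_union.1 hmem with hmem | hmem
            · exact h.notMem i hi ((hVF _).1 hmem).2
            · obtain ⟨i', hi', e⟩ := mem_image.1 hmem
              have := h.injOn (specialNonfaces_subset C hC hi') hi e
              exact hij (hCj i hiN (this ▸ hi'))
          · have := hj i hiN
            rw [div_le_iff₀ (hlN i hiN)] at this
            exact sub_nonpos.2 this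
  · rw [hlF a haV haF, sub_self, mul_zero, sub_zero]
    exact mul_pos hfa (sub_pos.2 hl₀a)

end IsSpecialQuotient

/-- A neighborly polytope with at most 12 vertices does not have the special polytope as a quotient:
counting dimensions and positive entries of dependences leaves only the case that `F` has `m = 2` or
`m = 3` vertices and `⌊dim Q / 2⌋ = m + 1`, which `false_of_dependences` excludes. -/
theorem IsSpecialQuotient.thirteen_le_numVertices [FiniteDimensional ℝ E]
    (h : IsSpecialQuotient Q F q) (hQ : IsPolytope Q) (hN : IsNeighborly Q) :
    13 ≤ numVertices Q := by
  classical
  obtain ⟨V, hV⟩ := hQ.finite_extremePoints.exists_finset_coe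
  have hn : numVertices Q = V.card := by rw [numVertices, ← hV, Set.ncard_coe_finset]
  rw [hn]
  by_contra! hlt
  obtain ⟨VF, hVF⟩ : ∃ VF : Finset E, ∀ x, x ∈ VF ↔ x ∈ V ∧ x ∈ F :=
    ⟨V.filter (· ∈ F), fun x => mem_filter⟩
  have hVFV : VF ⊆ V := fun x hx => ((hVF x).1 hx).1
  have hm := h.card_add_nine_le hV hVF
  have hm3 : VF.card ≤ 3 := by omega
  have hqV := h.mem_vertices hV
  have hdimlt := hQ.polytopeDim_lt_card hV ⟨q 1, hqV 1 (by decide)⟩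
  have hdim := h.card_add_five_le_polytopeDim hQ hV hVF hm3
  obtain ⟨k, hk⟩ : ∃ k, k = polytopeDim Q / 2 := ⟨_, rfl⟩
  have hNk : IsKNeighborly k Q := hk ▸ hN
  have hkV : k < V.card := by omega
  -- the dependences of the non-faces
  have hdep : ∀ C ∈ specialNonfaces, ∃ f, IsAffineDependence V f ∧
      (∀ v ∈ V, v ∉ VF ∪ C.image q → f v ≤ 0) ∧
      ∀ S : Finset E, (∀ v ∈ V, 0 < f v → v ∈ S) → k < S.card := by
    intro C hC
    have hCI := specialNonfaces_subset C hC
    have hC3 : C.Nonempty ∧ C.card ≤ 3 :=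
      (by decide : ∀ C ∈ specialNonfaces, C.Nonempty ∧ C.card ≤ 3) C hC
    have hsub : VF ∪ C.image q ⊆ V := by
      refine union_subset hVFV fun x hx => ?_
      obtain ⟨i, hi, rfl⟩ := mem_image.1 hx
      exact hqV i (hCI hi)
    have hssub : VF ∪ C.image q ⊂ V := by
      refine hsub.ssubset_of_ne fun e => ?_
      have h1 := card_union_le VF (C.image q)
      have h2 := card_image_le (s := C) (f := q)
      rw [e] at h1
      omega
    obtain ⟨f, hf, hf0, hne⟩ := exists_isAffineDependence_nonpos_off hQ hV hssub
      ((hC3.1.image q).inr) fun G hG hSG => by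
        refine h.eq_of_nonface C hC G hG ?_ fun i hi => hSG (by
          exact mem_coe.2 (mem_union_right _ (mem_image_of_mem q hi)))
        refine hQ.face_subset_of_extremePoints h.isExposed hG fun v hv hvF => hSG ?_
        exact mem_coe.2 (mem_union_left _ ((hVF v).2 ⟨mem_coe.1 (hV ▸ hv), hvF⟩))
    exact ⟨f, hf, hf0, fun S hS => hNk.lt_card_pos hQ hV hkV hf hne hS⟩
  have hpos : ∀ C ∈ specialNonfaces, ∀ f : E → ℝ,
      (∀ v ∈ V, v ∉ VF ∪ C.image q → f v ≤ 0) → ∀ v ∈ V, 0 < f v → v ∈ VF ∪ C.image q :=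
    fun C hC f hf v hv hfv => by
      by_contra hvS
      exact hfv.not_ge (hf v hv hvS)
  have hkm : k = VF.card + 1 := by
    obtain ⟨f, -, hf0, hfk⟩ := hdep {1, 6} (by decide)
    have h1 := hfk _ (hpos {1, 6} (by decide) f hf0)
    have h2 := card_union_le VF (({1, 6} : Finset ℕ).image q)
    have h3 := card_image_le (s := ({1, 6} : Finset ℕ)) (f := q)
    have h4 : ({1, 6} : Finset ℕ).card = 2 := rfl
    omega
  have hVq : ∀ v ∈ V, v ∈ F ∨ ∃ i ∈ Icc 1 9, q i = v := by
    intro x hx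
    by_contra! hcon
    obtain ⟨hxF, hxq⟩ := hcon
    have hxVF : x ∉ VF := fun hmem => hxF ((hVF x).1 hmem).2
    have hsub : ((insert x VF : Finset E) : Set E) ⊆ Q.extremePoints ℝ := by
      rw [← hV]
      exact coe_subset.2 (insert_subset hx hVFV)
    have hG := hNk (insert x VF) hsub (by rw [card_insert_of_notMem hxVF, hkm])
    have hFG := hQ.face_subset_of_extremePoints h.isExposed hG fun v hv hvF =>
      subset_convexHull ℝ _ (mem_coe.2 (mem_insert_of_mem ((hVF v).2 ⟨mem_coe.1 (hV ▸ hv), hvF⟩)))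
    obtain ⟨i, hi, hqi⟩ := h.exists_mem _ hG ⟨hFG, fun hGF => hxF (hGF
      (subset_convexHull ℝ _ (mem_coe.2 (mem_insert_self x VF))))⟩
    have hmem := mem_of_mem_convexHull_extremePoints hQ.convex hsub (h.mem_extremePoints i hi) hqi
    rcases mem_insert.1 (mem_coe.1 hmem) with e | hmem
    · exact hxq i hi e
    · exact h.notMem i hi ((hVF _).1 hmem).2
  -- the dependence of the triangle has a positive entry on `F`
  obtain ⟨a, ha, hfa⟩ : ∃ a ∈ VF, ∃ f, IsAffineDependence V f ∧
      (∀ v ∈ V, v ∉ VF ∪ ({7, 8, 9} : Finset ℕ).image q → f v ≤ 0) ∧ 0 < f a := by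
    obtain ⟨f, hf, hf0, hfk⟩ := hdep {7, 8, 9} (by decide)
    by_contra! hcon
    have h1 := hfk (({7, 8, 9} : Finset ℕ).image q) fun v hv hfv =>
      (mem_union.1 (hpos _ (by decide) f hf0 v hv hfv)).resolve_left
        fun hvF => hfv.not_ge (hcon v hvF f hf hf0)
    have h2 := card_image_le (s := ({7, 8, 9} : Finset ℕ)) (f := q)
    have h3 : ({7, 8, 9} : Finset ℕ).card = 3 := rfl
    omega
  refine h.false_of_dependences hQ hV hVF hm3 hVq ha fun C hC => ?_
  have hC2 : C = {7, 8, 9} ∨ C.card = 2 :=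
    (by decide : ∀ C ∈ specialNonfaces, C = {7, 8, 9} ∨ C.card = 2) C hC
  rcases hC2 with rfl | hC2
  · exact hfa
  -- the dependence of a segment is positive on all of `F`
  obtain ⟨f, hf, hf0, hfk⟩ := hdep C hC
  refine ⟨f, hf, hf0, ?_⟩
  by_contra hfa'
  have h1 := hfk ((VF ∪ C.image q).erase a) fun v hv hfv =>
    mem_erase.2 ⟨fun e => hfa' (e ▸ hfv), hpos C hC f hf0 v hv hfv⟩
  rw [card_erase_of_mem (mem_union_left _ ha)] at h1
  have h2 := card_union_le VF (C.image q)
  have h3 := card_image_le (s := C) (f := q)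
  omega

end Bound

/-! ### A realization of the special polytope -/

section Realization

open Finset

theorem mem_extremePoints_convexHull_of_forall_lt {E : Type*} [NormedAddCommGroup E]
    [NormedSpace ℝ E] {S : Finset E} (l : StrongDual ℝ E) {x : E} (hx : x ∈ S)
    (hl : ∀ y ∈ S, y ≠ x → l y < l x) : x ∈ (convexHull ℝ (S : Set E)).extremePoints ℝ := by
  have hP : IsPolytope (convexHull ℝ (S : Set E)) := ⟨S, ⟨x, hx⟩, rfl⟩
  have hle : ∀ y ∈ convexHull ℝ (S : Set E), l y ≤ l x := by
    refine le_of_mem_convexHull fun y hy => ?_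
    by_cases hyx : y = x
    · rw [hyx]
    · exact (hl y hy hyx).le
  have hG := hP.convexHull_extremePoints_inter (isExposed_of_le hle)
  have hxG : x ∈ {y ∈ convexHull ℝ (S : Set E) | l y = l x} := ⟨subset_convexHull ℝ _ hx, rfl⟩
  rw [← hG] at hxG
  obtain ⟨y, hy, -, hyx⟩ := convexHull_nonempty_iff.1 ⟨x, hxG⟩
  have : y = x := by
    by_contra hne
    exact (hl y (extremePoints_convexHull_subset hy) hne).ne hyx
  rwa [← this]

/-- A polytope in a 5-dimensional space is a realization of the special polytope if its vertices are
`v 1, …, v 9` and these satisfy the conditions on a quotient with `F` the empty face. -/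
theorem IsSpecialQuotient.isSpecialPolytope {E : Type*} [NormedAddCommGroup E]
    [NormedSpace ℝ E] [FiniteDimensional ℝ E] (hE : Module.finrank ℝ E = 5) {P : Set E}
    {v : ℕ → E} (h : IsSpecialQuotient P ∅ v) (hP : IsPolytope P)
    (hext : P.extremePoints ℝ = v '' (Icc 1 9 : Finset ℕ)) :
    IsSpecialPolytope P ∧ IsSimplicial P ∧ numVertices P = 9 := by
  classical
  have hV : (((Icc 1 9).image v : Finset E) : Set E) = P.extremePoints ℝ := by
    rw [hext, coe_image]
  have hVF : ∀ x, x ∈ (∅ : Finset E) ↔ x ∈ (Icc 1 9).image v ∧ x ∈ (∅ : Set E) := by simp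
  have hdim : polytopeDim P = 5 := by
    refine le_antisymm (hE ▸ Submodule.finrank_le _) ?_
    simpa using h.card_add_five_le_polytopeDim hP hV hVF (by simp)
  -- a face is the convex hull of the vertices with labels in the set `S` of its labels
  have hface : ∀ G, IsExposed ℝ P G → ∀ S : Finset ℕ, S ⊆ Icc 1 9 →
      (∀ i ∈ Icc 1 9, v i ∈ G ↔ i ∈ S) →
      P.extremePoints ℝ ∩ G = v '' (S : Set ℕ) ∧ G = convexHull ℝ (v '' (S : Set ℕ)) := by
    intro G hG S hS hSG
    have h1 : P.extremePoints ℝ ∩ G = v '' (S : Set ℕ) := by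
      rw [hext]
      ext x
      constructor
      · rintro ⟨⟨i, hi, rfl⟩, hx⟩
        exact ⟨i, (hSG i hi).1 hx, rfl⟩
      · rintro ⟨i, hi, rfl⟩
        exact ⟨⟨i, hS hi, rfl⟩, (hSG i (hS hi)).2 hi⟩
    exact ⟨h1, by rw [← h1, hP.convexHull_extremePoints_inter hG]⟩
  have hind : ∀ T ∈ specialFacets, AffineIndependent ℝ (fun x : v '' (T : Set ℕ) => (x : E)) := by
    intro T hT
    obtain ⟨j, hj, hjT⟩ :=
      (by decide : ∀ T ∈ specialFacets, ∃ j ∈ Icc 1 9, j ∉ T) T hT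
    refine (h.affineIndependent hP hV hVF (by simp) hT hj hjT).mono
      (s := v '' (T : Set ℕ)) ?_
    rintro _ ⟨i, hi, rfl⟩
    exact mem_coe.2 (mem_insert_of_mem (mem_union_right _ (mem_image_of_mem v hi)))
  have hfacet : ∀ T ∈ specialFacets, IsPolytopeFacet P (convexHull ℝ (v '' (T : Set ℕ))) := by
    intro T hT
    obtain ⟨G, hG, -, hGT⟩ := h.exists_face T hT
    have hTI := specialFacets_subset T hT
    obtain ⟨-, hGeq⟩ := hface G hG T hTI hGT
    refine ⟨hGeq ▸ hG, ?_, ?_⟩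
    · have : T.Nonempty := card_pos.1 (by rw [specialFacets_card T hT]; norm_num)
      exact ((coe_nonempty.2 this).image v).convexHull
    · have h1 : (T.image v).card = 4 + 1 := by
        rw [card_image_of_injOn (h.injOn.mono (coe_subset.2 hTI)), specialFacets_card T hT]
      have h2 := (hind T hT).mono (s := ((T.image v : Finset E) : Set E)) (by simp)
      have h3 := AffineIndependent.finrank_vectorSpan (ι := ↥(T.image v)) h2 (n := 4)
        (by rw [Fintype.card_coe, h1])
      rw [hdim, polytopeDim, ← direction_affineSpan, affineSpan_convexHull, direction_affineSpan]
      have h4 : Set.range (fun x : ↥(T.image v) => (x : E)) = v '' (T : Set ℕ) := by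
        ext x
        simp
      rw [← h4]
      exact congrArg (· + 1) h3
  have hfacet' : ∀ G, IsPolytopeFacet P G →
      ∃ T ∈ specialFacets, P.extremePoints ℝ ∩ G = v '' (T : Set ℕ) ∧
        G = convexHull ℝ (v '' (T : Set ℕ)) := by
    rintro G ⟨hG, hGne, hGdim⟩
    obtain ⟨S, hS⟩ : ∃ S : Finset ℕ, ∀ i, i ∈ S ↔ i ∈ Icc 1 9 ∧ v i ∈ G :=
      ⟨(Icc 1 9).filter (v · ∈ G), fun i => mem_filter⟩
    have hSI : S ⊆ Icc 1 9 := fun i hi => ((hS i).1 hi).1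
    obtain ⟨hGV, hGeq⟩ := hface G hG S hSI fun i hi => by simp [hS, hi]
    obtain ⟨T, hT, hST⟩ := exists_specialFacet_superset hSI fun C hC hCS => by
      have := h.eq_of_nonface C hC G hG (Set.empty_subset _) fun i hi => ((hS i).1 (hCS hi)).2
      rw [this] at hGdim
      omega
    have hSne : S.Nonempty := by
      rw [hGeq, convexHull_nonempty_iff] at hGne
      exact coe_nonempty.1 hGne.of_image
    have hScard : 5 ≤ S.card := by
      have hpos := card_pos.2 hSne
      have h1 := finrank_vectorSpan_image_finset_le ℝ v S (n := S.card - 1) (by omega)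
      rw [hGeq, hdim, polytopeDim, ← direction_affineSpan, affineSpan_convexHull,
        direction_affineSpan] at hGdim
      rw [coe_image] at h1
      omega
    have : S = T := eq_of_subset_of_card_le hST (by rwa [specialFacets_card T hT])
    exact ⟨T, hT, this ▸ hGV, this ▸ hGeq⟩
  refine ⟨⟨hP, hdim, v, ?_, ?_⟩, ?_, ?_⟩
  · rw [hext, coe_Icc]
    exact Set.InjOn.bijOn_image (by simpa using h.injOn)
  · ext G
    constructor
    · intro hG
      obtain ⟨T, hT, -, hGT⟩ := hfacet' G hG
      exact ⟨T, hT, hGT⟩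
    · rintro ⟨T, hT, rfl⟩
      exact hfacet T hT
  · intro G hG
    obtain ⟨T, hT, hGT, -⟩ := hfacet' G hG
    refine (hind T hT).mono (s := G.extremePoints ℝ) ?_
    rw [hG.1.isExtreme.extremePoints_eq, Set.inter_comm, hGT]
  · rw [numVertices, hext, h.injOn.ncard_image, Set.ncard_coe_finset, Nat.card_Icc]

/-- Coordinates of the vertices: the free sum of an octahedron with vertices `±e₁`, `±e₂`, `±e₃` and
a triangle with vertices `e₄`, `e₅`, `-e₄ - e₅`. -/
def specialCoord : ℕ → Fin 5 → ℤ
  | 1 => ![1, 0, 0, 0, 0]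
  | 2 => ![0, 1, 0, 0, 0]
  | 3 => ![0, 0, 1, 0, 0]
  | 4 => ![0, -1, 0, 0, 0]
  | 5 => ![0, 0, -1, 0, 0]
  | 6 => ![-1, 0, 0, 0, 0]
  | 7 => ![0, 0, 0, 1, 0]
  | 8 => ![0, 0, 0, 0, 1]
  | 9 => ![0, 0, 0, -1, -1]
  | _ => 0

/-- The outer normal of the facet `T`, scaled to take the value `1` on `T`. -/
def specialNormal (T : Finset ℕ) : Fin 5 → ℤ :=
  ![if 1 ∈ T then 1 else -1, if 2 ∈ T then 1 else -1, if 3 ∈ T then 1 else -1,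
    if 7 ∈ T then 1 else -2, if 8 ∈ T then 1 else -2]

theorem specialNormal_dotProduct_specialCoord : ∀ T ∈ specialFacets, ∀ i ∈ Icc 1 9,
    specialNormal T ⬝ᵥ specialCoord i ≤ 1 ∧
      (specialNormal T ⬝ᵥ specialCoord i = 1 ↔ i ∈ T) := by decide

theorem specialCoord_dotProduct_lt : ∀ i ∈ Icc 1 9, ∀ j ∈ Icc 1 9, j ≠ i →
    specialCoord i ⬝ᵥ specialCoord j < specialCoord i ⬝ᵥ specialCoord i := by decide

theorem sum_specialCoord_eq_zero : ∀ C ∈ specialNonfaces, ∑ i ∈ C, specialCoord i = 0 := by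
  decide

theorem exists_isSpecialPolytope : ∃ P : Set (EuclideanSpace ℝ (Fin 5)),
    IsSpecialPolytope P ∧ IsSimplicial P ∧ numVertices P = 9 := by
  classical
  obtain ⟨v, hv⟩ : ∃ v : ℕ → EuclideanSpace ℝ (Fin 5), ∀ i k, v i k = specialCoord i k :=
    ⟨fun i => WithLp.toLp 2 fun k => (specialCoord i k : ℝ), fun _ _ => rfl⟩
  have hdual : ∀ u : Fin 5 → ℤ, ∃ l : StrongDual ℝ (EuclideanSpace ℝ (Fin 5)),
      ∀ i, l (v i) = (u ⬝ᵥ specialCoord i : ℤ) := by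
    intro u
    refine ⟨∑ k, (u k : ℝ) • EuclideanSpace.proj k, fun i => ?_⟩
    simp [dotProduct, hv]
  have hlt : ∀ i ∈ Icc 1 9, ∃ l : StrongDual ℝ (EuclideanSpace ℝ (Fin 5)),
      ∀ j ∈ Icc 1 9, j ≠ i → l (v j) < l (v i) := by
    intro i hi
    obtain ⟨l, hl⟩ := hdual (specialCoord i)
    refine ⟨l, fun j hj hji => ?_⟩
    rw [hl, hl]
    exact_mod_cast specialCoord_dotProduct_lt i hi j hj hji
  have hinj : Set.InjOn v (Icc 1 9 : Finset ℕ) := by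
    intro i hi j hj hij
    by_contra hne
    obtain ⟨l, hl⟩ := hlt j hj
    exact (hl i hi hne).ne (congrArg l hij)
  set P : Set (EuclideanSpace ℝ (Fin 5)) := convexHull ℝ (((Icc 1 9).image v : Finset _) : Set _)
    with hPdef
  have hP : IsPolytope P := ⟨_, (nonempty_Icc.2 (by norm_num)).image v, rfl⟩
  have hvP : ∀ i ∈ Icc 1 9, v i ∈ P := fun i hi =>
    subset_convexHull ℝ _ (mem_coe.2 (mem_image_of_mem v hi))
  have hvext : ∀ i ∈ Icc 1 9, v i ∈ P.extremePoints ℝ := by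
    intro i hi
    obtain ⟨l, hl⟩ := hlt i hi
    refine mem_extremePoints_convexHull_of_forall_lt l (mem_image_of_mem v hi) fun y hy hyi => ?_
    obtain ⟨j, hj, rfl⟩ := mem_image.1 hy
    exact hl j hj fun e => hyi (e ▸ rfl)
  have hext : P.extremePoints ℝ = v '' (Icc 1 9 : Finset ℕ) := by
    refine Set.Subset.antisymm ?_ ?_
    · rw [← coe_image]
      exact extremePoints_convexHull_subset
    · rintro _ ⟨i, hi, rfl⟩
      exact hvext i hi
  have hle : ∀ {l : StrongDual ℝ (EuclideanSpace ℝ (Fin 5))} {c : ℝ},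
      (∀ i ∈ Icc 1 9, l (v i) ≤ c) → ∀ x ∈ P, l x ≤ c := by
    intro l c h
    refine le_of_mem_convexHull fun x hx => ?_
    obtain ⟨i, hi, rfl⟩ := mem_image.1 (mem_coe.1 hx)
    exact h i hi
  have hsum : ∀ l : StrongDual ℝ (EuclideanSpace ℝ (Fin 5)), ∀ C ∈ specialNonfaces,
      ∑ i ∈ C, l (v i) = 0 := by
    intro l C hC
    rw [← map_sum]
    have : ∑ i ∈ C, v i = 0 := by
      ext k
      have h := congrFun (sum_specialCoord_eq_zero C hC) k
      simp only [Finset.sum_apply, Pi.zero_apply] at h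
      simp only [WithLp.ofLp_sum, Finset.sum_apply, hv, PiLp.zero_apply]
      exact_mod_cast h
    rw [this, map_zero]
  refine ⟨P, IsSpecialQuotient.isSpecialPolytope (v := v) (by simp)
    ⟨isExposed_empty, hvext, fun _ _ => Set.notMem_empty _, hinj, ?_, ?_, ?_⟩ hP hext⟩
  · intro G hG hne
    rw [← hP.convexHull_extremePoints_inter hG, Set.empty_ssubset, convexHull_nonempty_iff,
      hext] at hne
    obtain ⟨_, ⟨i, hi, rfl⟩, hiG⟩ := hne
    exact ⟨i, hi, hiG⟩
  · -- the origin is the barycenter of each minimal non-face, so the functional of a face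
    -- containing one of them has maximum `0` and vanishes on all vertices
    intro C hC G hG _ hCG
    obtain ⟨l, c, hlc, hl⟩ := hG.exists_support
    have hCI := specialNonfaces_subset C hC
    have hc : c = 0 := by
      have h1 := hsum l C hC
      rw [sum_congr rfl fun i hi => (hl (v i) (hvP i (hCI hi))).2 (hCG i hi), sum_const,
        nsmul_eq_mul] at h1
      have h2 : C.card ≠ 0 := (by decide : ∀ C ∈ specialNonfaces, C.card ≠ 0) C hC
      exact (mul_eq_zero.1 h1).resolve_left (Nat.cast_ne_zero.2 h2)
    refine hG.subset.antisymm (hP.face_subset_of_extremePoints (IsExposed.refl P) hG ?_)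
    intro x hx _
    rw [hext] at hx
    obtain ⟨i, hi, rfl⟩ := hx
    obtain ⟨D, hD, hiD⟩ :=
      (by decide : ∀ i ∈ Icc 1 9, ∃ D ∈ specialNonfaces, i ∈ D) i (mem_coe.1 hi)
    refine (hl _ (hvP i hi)).1 ?_
    rw [hc]
    exact (sum_eq_zero_iff_of_nonpos fun k hk =>
      hc ▸ hlc _ (hvP k (specialNonfaces_subset D hD hk))).1 (hsum l D hD) i hiD
  · intro T hT
    obtain ⟨l, hl⟩ := hdual (specialNormal T)
    refine ⟨_, isExposed_of_le (hle (l := l) (c := 1) fun i hi => ?_), Set.empty_subset _,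
      fun i hi => ?_⟩
    · rw [hl]
      exact_mod_cast (specialNormal_dotProduct_specialCoord T hT i hi).1
    · have h1 := (specialNormal_dotProduct_specialCoord T hT i hi).2
      rw [← h1]
      constructor
      · intro h
        have := h.2
        rw [hl] at this
        exact_mod_cast this
      · intro h
        exact ⟨hvP i hi, by rw [hl, h]; norm_num⟩

end Realization

/-! ### Existence, the lower bound, and consequences -/

theorem mainTheorem4 :
    -- the special polytope exists, and it is simplicial with 9 vertices
    (∃ P : Set (EuclideanSpace ℝ (Fin 5)),
      IsSpecialPolytope P ∧ IsSimplicial P ∧ numVertices P = 9) ∧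
    -- every neighborly polytope that has it as a quotient has at least 13 vertices
    (∀ (m n : ℕ) (P : Set (EuclideanSpace ℝ (Fin m))) (Q : Set (EuclideanSpace ℝ (Fin n))),
      IsSpecialPolytope P → IsPolytope Q → IsNeighborly Q → IsQuotientOf P Q →
        13 ≤ numVertices Q) ∧
    -- hence some simplicial `d`-polytope with `d + 4` vertices, `d = 5`, is not a quotient of any
    -- neighborly `(2d - 2)`-polytope with `2d + 2` vertices
    (∃ P : Set (EuclideanSpace ℝ (Fin 5)),
      IsPolytope P ∧ IsSimplicial P ∧ polytopeDim P = 5 ∧ numVertices P = 5 + 4 ∧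
        ∀ (n : ℕ) (Q : Set (EuclideanSpace ℝ (Fin n))),
          IsPolytope Q → IsNeighborly Q → polytopeDim Q = 2 * 5 - 2 →
            numVertices Q = 2 * 5 + 2 → ¬ IsQuotientOf P Q) ∧
    -- so it is not true in general that such quotient representations exist
    ¬ (∀ (d : ℕ), 2 ≤ d → ∀ (m : ℕ) (P : Set (EuclideanSpace ℝ (Fin m))),
      IsPolytope P → IsSimplicial P → polytopeDim P = d → numVertices P = d + 4 →
        ∃ (n : ℕ) (Q : Set (EuclideanSpace ℝ (Fin n))),
          IsPolytope Q ∧ IsNeighborly Q ∧ polytopeDim Q = 2 * d - 2 ∧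
            numVertices Q = 2 * d + 2 ∧ IsQuotientOf P Q) := by
  obtain ⟨P, hP, hs, hn⟩ := exists_isSpecialPolytope
  have hbound : ∀ (m n : ℕ) (P : Set (EuclideanSpace ℝ (Fin m)))
      (Q : Set (EuclideanSpace ℝ (Fin n))), IsSpecialPolytope P → IsPolytope Q →
      IsNeighborly Q → IsQuotientOf P Q → 13 ≤ numVertices Q := by
    intro m n P Q hP hQ hN hPQ
    obtain ⟨F, q, h⟩ := hP.exists_isSpecialQuotient hQ hPQ
    exact h.thirteen_le_numVertices hQ hN
  refine ⟨⟨P, hP, hs, hn⟩, hbound, ⟨P, hP.1, hs, hP.2.1, hn, fun n Q hQ hN _ hQn hPQ => ?_⟩,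
    fun h => ?_⟩
  · have := hbound 5 n P Q hP hQ hN hPQ
    omega
  · obtain ⟨n, Q, hQ, hN, -, hQn, hPQ⟩ := h 5 (by norm_num) 5 P hP.1 hs hP.2.1 hn
    have := hbound 5 n P Q hP hQ hN hPQ
    omega
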